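/- **Setting.** Let $V_1,V_2$ be finite non-empty sets of agents ($n_l=|V_l|$) and $A_1,A_2$ finite non-empty sets of pure actions ($M_l=|A_l|$), and let $\Delta(A_l)$ be the simplex of mixed strategies on $A_l$. Each agent $i\in V_l$ has a cost $f_{l,i}:A_1\times A_2\to\mathbb R$, extended to mixed profiles by $f_{l,i}(x_1,x_2)=\sum_{p,q}x_1^{(p)}x_2^{(q)}f_{l,i}(p,q)$. Put $f_l=\frac1{n_l}\sum_{i\in V_l}f_{l,i}$ and assume that $f_1+f_2=0$ on $\Delta(A_1)\times\Delta(A_2)$. With $U=f_1$, a profile $(x_1^*,x_2^*)\in\Delta(A_1)\times\Delta(A_2)$ is a mixed-strategy Nash equilibrium (NE) if $x_1^*$ minimizes $U(\cdot,x_2^*)$ over $\Delta(A_1)$ and $x_2^*$ maximizes $U(x_1^*,\cdot)$ over $\Delta(A_2)$. **Network.** At each time $k\ge 0$ there are a directed graph $\mathcal G_l(k)$ on $V_l$ ($l=1,2$) and a bipartite directed graph $\mathcal G_{12}(k)$ with edges only between $V_1$ and $V_2$. For $i\in V_l$ let $\mathcal N_l^i(k)\subseteq V_l$ and $\mathcal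 N_{12,l}^i(k)\subseteq V_{3-l}$ be the sets of $j$ with an edge from $j$ to $i$ in $\mathcal G_l(k)$ and in $\mathcal G_{12}(k)$, respectively. Assume, for $l=1,2$: * there is an integer $B_l\ge1$ such that $\bigcup_{t=k}^{k+B_l-1}\mathcal G_l(t)$ is strongly connected for every $k\ge0$; * $i\in\mathcal N_l^i(k)$ (every agent is one of its own neighbors) and $\mathcal N_{12,l}^i(k)\neq\emptyset$ for all $i\in V_l$ and $k\ge 0$; * there are real weights $w_{l,ij}(k)$ ($i,j\in V_l$) and $w_{12,ij}(k)$ ($i\in V_l$, $j\in V_{3-l}$) and one $\eta\in(0,1)$ such that $w_{l,ij}(k)\ge\eta$ if $j\in\mathcal N_l^i(k)$ and $w_{l,ij}(k)=0$ otherwise, and $w_{12,ij}(k)\ge\eta$ if $j\in\mathcal N_{12,l}^i(k)$ and $w_{12,ij}(k)=0$ otherwise; * $\sum_{j\in V_l}w_{l,ij}(k)=1$ for all $i\in V_l$, $\sum_{i\in V_l}w_{l,ij}(k)=1$ for all $j\in V_l$, and $\sum_{j\in V_{3-l}}w_{12,ij}(k)=1$ for all $i\in V_l$. **Algorithm (distributed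 multiplicative weights).** Let $(\alpha(t))_{t\ge0}$ be positive and non-increasing. Start from the uniform distributions $x_{l,i}(0)=\frac1{M_l}(1,\dots,1)$, $i\in V_l$. At time $t$, each $i\in V_l$ forms $$v_{l,i}(t)=\sum_{j\in\mathcal N_l^i(t)}w_{l,ij}(t)\,x_{l,j}(t),\qquad u_{3-l,i}(t)=\sum_{j\in\mathcal N_{12,l}^i(t)}w_{12,ij}(t)\,x_{3-l,j}(t),$$ computes $g_{1,i}^{(p)}(t)=f_{1,i}(p,u_{2,i}(t))$ for $p\in A_1$ if $l=1$, or $g_{2,i}^{(p)}(t)=f_{2,i}(u_{1,i}(t),p)$ for $p\in A_2$ if $l=2$, and updates $$x_{l,i}^{(p)}(t+1)=\frac{v_{l,i}^{(p)}(t)\,e^{-\alpha(t)g_{l,i}^{(p)}(t)}}{\sum_{k\in A_l}v_{l,i}^{(k)}(t)\,e^{-\alpha(t)g_{l,i}^{(k)}(t)}}.$$ **Theorem.** Suppose that $\sum_{t}\alpha(t)=\infty$ and $\sum_t\alpha(t)^2<\infty$, and that the set of mixed-strategy NE has an interior point relative to $\Delta(A_1)\times\Delta(A_2)$. Then there is a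 mixed-strategy NE $(x_1^*,x_2^*)$ such that $\lim_{t\to\infty}x_{1,i}(t)=x_1^*$ for all $i\in V_1$ and $\lim_{t\to\infty}x_{2,j}(t)=x_2^*$ for all $j\in V_2$. -/

import Mathlib

open Filter Topology

noncomputable section

/-- A directed graph is strongly connected if there is a directed path (possibly of length zero)
from every vertex to every other vertex. -/
def Digraph.StronglyConnected {V : Type*} (G : Digraph V) : Prop :=
  ∀ i j : V, Relation.ReflTransGen G.Adj i j

/-- A sequence of directed graphs is uniformly jointly strongly connected if, for some window
length `B ≥ 1`, the union of the graphs over each window `k, k + 1, …, k + B - 1` is strongly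
connected. -/
def UniformlyJointlyStronglyConnected {V : Type*} (G : ℕ → Digraph V) : Prop :=
  ∃ B : ℕ, 0 < B ∧ ∀ k : ℕ, (⨆ t ∈ Set.Ico k (k + B), G t).StronglyConnected

namespace SubnetworkGame

/-- The expected value of a pure-profile cost `c` at the mixed profile `(x₁, x₂)`. -/
def mixedCost {A₁ A₂ : Type*} [Fintype A₁] [Fintype A₂] (c : A₁ → A₂ → ℝ)
    (x₁ : A₁ → ℝ) (x₂ : A₂ → ℝ) : ℝ :=
  ∑ p, ∑ q, x₁ p * x₂ q * c p q

/-- The global cost of a subnetwork with agents `V`: the average of the expected costs of its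
agents. -/
def globalCost {V A₁ A₂ : Type*} [Fintype V] [Fintype A₁] [Fintype A₂] (f : V → A₁ → A₂ → ℝ)
    (x₁ : A₁ → ℝ) (x₂ : A₂ → ℝ) : ℝ :=
  (1 / (Fintype.card V : ℝ)) * ∑ i, mixedCost (f i) x₁ x₂

/-- The game is zero-sum between the subnetworks: the two global costs add up to zero at every
mixed profile (the individual costs need not be related). -/
def IsZeroSum {V₁ V₂ A₁ A₂ : Type*} [Fintype V₁] [Fintype V₂] [Fintype A₁] [Fintype A₂]
    (f₁ : V₁ → A₁ → A₂ → ℝ) (f₂ : V₂ → A₁ → A₂ → ℝ) : Prop :=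
  ∀ x₁ ∈ stdSimplex ℝ A₁, ∀ x₂ ∈ stdSimplex ℝ A₂,
    globalCost f₁ x₁ x₂ + globalCost f₂ x₁ x₂ = 0

/-- The set of mixed-strategy Nash equilibria, for the cost `U` which is the global cost of the
first (minimizing) subnetwork and the negative of that of the second one. -/
def nashSet {V₁ A₁ A₂ : Type*} [Fintype V₁] [Fintype A₁] [Fintype A₂]
    (f₁ : V₁ → A₁ → A₂ → ℝ) : Set ((A₁ → ℝ) × (A₂ → ℝ)) :=
  {x | x.1 ∈ stdSimplex ℝ A₁ ∧ x.2 ∈ stdSimplex ℝ A₂ ∧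
    IsMinOn (fun y₁ => globalCost f₁ y₁ x.2) (stdSimplex ℝ A₁) x.1 ∧
    IsMaxOn (fun y₂ => globalCost f₁ x.1 y₂) (stdSimplex ℝ A₂) x.2}

/-- `x` is an interior point of the set `S` of mixed profiles, relative to the set of all mixed
profiles: `S` contains every mixed profile that is close enough to `x`. -/
def IsInteriorPoint {A₁ A₂ : Type*} [Fintype A₁] [Fintype A₂]
    (S : Set ((A₁ → ℝ) × (A₂ → ℝ))) (x : (A₁ → ℝ) × (A₂ → ℝ)) : Prop :=
  x ∈ S ∧ ∃ ε > 0, Metric.ball x ε ∩ (stdSimplex ℝ A₁ ×ˢ stdSimplex ℝ A₂) ⊆ S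

/-- The time-varying communication network: the directed graph inside each subnetwork, the
bipartite directed graph between them, and the weights which the agents put on what they receive.
An edge `(j, i)` means that `j` can send information to `i`. The entry `(i, j)` of each weight
matrix is the weight that the receiver `i` puts on the sender `j`; thus `W₁₂ k` holds the weights
of the agents in `V₁` on those in `V₂`, and `W₂₁ k` those of the agents in `V₂` on those in `V₁`. -/
structure Network (V₁ V₂ : Type*) where
  G₁ : ℕ → Digraph V₁
  G₂ : ℕ → Digraph V₂
  G₁₂ : ℕ → Digraph (V₁ ⊕ V₂)
  bipartite_left : ∀ k i j, ¬ (G₁₂ k).Adj (Sum.inl i) (Sum.inl j)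
  bipartite_right : ∀ k i j, ¬ (G₁₂ k).Adj (Sum.inr i) (Sum.inr j)
  W₁ : ℕ → Matrix V₁ V₁ ℝ
  W₂ : ℕ → Matrix V₂ V₂ ℝ
  W₁₂ : ℕ → Matrix V₁ V₂ ℝ
  W₂₁ : ℕ → Matrix V₂ V₁ ℝ

namespace Network

variable {V₁ V₂ : Type*} (N : Network V₁ V₂)

/-- Neighbors of `i : V₁` in its own subnetwork. -/
def nbr₁ (k : ℕ) (i : V₁) : Set V₁ := {j | (N.G₁ k).Adj j i}

/-- Neighbors of `i : V₂` in its own subnetwork. -/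
def nbr₂ (k : ℕ) (i : V₂) : Set V₂ := {j | (N.G₂ k).Adj j i}

/-- Neighbors of `i : V₁` in the other subnetwork. -/
def nbr₁₂ (k : ℕ) (i : V₁) : Set V₂ := {j | (N.G₁₂ k).Adj (Sum.inr j) (Sum.inl i)}

/-- Neighbors of `i : V₂` in the other subnetwork. -/
def nbr₂₁ (k : ℕ) (i : V₂) : Set V₁ := {j | (N.G₁₂ k).Adj (Sum.inl j) (Sum.inr i)}

/-- The standing assumption on the communication network. -/
structure Admissible [Fintype V₁] [Fintype V₂] : Prop where
  connected₁ : UniformlyJointlyStronglyConnected N.G₁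
  connected₂ : UniformlyJointlyStronglyConnected N.G₂
  /-- each agent is among its own neighbors: it always has access to its own estimate -/
  self₁ : ∀ k i, i ∈ N.nbr₁ k i
  self₂ : ∀ k i, i ∈ N.nbr₂ k i
  cross₁₂ : ∀ k i, (N.nbr₁₂ k i).Nonempty
  cross₂₁ : ∀ k i, (N.nbr₂₁ k i).Nonempty
  /-- weights on neighbors are uniformly bounded below -/
  weights_lower : ∃ η : ℝ, 0 < η ∧ η < 1 ∧ ∀ k,
    (∀ i, ∀ j ∈ N.nbr₁ k i, η ≤ N.W₁ k i j) ∧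
    (∀ i, ∀ j ∈ N.nbr₂ k i, η ≤ N.W₂ k i j) ∧
    (∀ i, ∀ j ∈ N.nbr₁₂ k i, η ≤ N.W₁₂ k i j) ∧
    (∀ i, ∀ j ∈ N.nbr₂₁ k i, η ≤ N.W₂₁ k i j)
  /-- weights on agents that are not neighbors vanish -/
  zero₁ : ∀ k i j, j ∉ N.nbr₁ k i → N.W₁ k i j = 0
  zero₂ : ∀ k i j, j ∉ N.nbr₂ k i → N.W₂ k i j = 0
  zero₁₂ : ∀ k i j, j ∉ N.nbr₁₂ k i → N.W₁₂ k i j = 0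
  zero₂₁ : ∀ k i j, j ∉ N.nbr₂₁ k i → N.W₂₁ k i j = 0
  row_sum₁ : ∀ k i, ∑ j, N.W₁ k i j = 1
  row_sum₂ : ∀ k i, ∑ j, N.W₂ k i j = 1
  col_sum₁ : ∀ k j, ∑ i, N.W₁ k i j = 1
  col_sum₂ : ∀ k j, ∑ i, N.W₂ k i j = 1
  row_sum₁₂ : ∀ k i, ∑ j, N.W₁₂ k i j = 1
  row_sum₂₁ : ∀ k i, ∑ j, N.W₂₁ k i j = 1

end Network

open scoped Classical in
/-- The weighted average of the estimates `x j` over the agents `j` in `S`. -/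
def weightedAverage {V A : Type*} [Fintype V] (S : Set V) (w : V → ℝ) (x : V → A → ℝ) : A → ℝ :=
  ∑ j ∈ Finset.univ.filter (fun j => j ∈ S), w j • x j

/-- One multiplicative-weights step from `v` with step-size `a` and gradient `g`. -/
def mwStep {A : Type*} [Fintype A] (a : ℝ) (g v : A → ℝ) : A → ℝ :=
  fun p => v p * Real.exp (-a * g p) / ∑ k, v k * Real.exp (-a * g k)

section Algorithm

variable {V₁ V₂ A₁ A₂ : Type*} [Fintype V₁] [Fintype V₂] [Fintype A₁] [Fintype A₂]

/-- The distributed multiplicative-weights algorithm: `mwIterates f₁ f₂ N α t` holds the estimates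
`x_{1,i}(t)`, `i : V₁`, and `x_{2,i}(t)`, `i : V₂`, of all agents at time `t`. -/
def mwIterates [DecidableEq A₁] [DecidableEq A₂]
    (f₁ : V₁ → A₁ → A₂ → ℝ) (f₂ : V₂ → A₁ → A₂ → ℝ) (N : Network V₁ V₂) (α : ℕ → ℝ) :
    ℕ → (V₁ → A₁ → ℝ) × (V₂ → A₂ → ℝ)
  | 0 => (fun _ _ => 1 / (Fintype.card A₁ : ℝ), fun _ _ => 1 / (Fintype.card A₂ : ℝ))
  | t + 1 =>
    let x := mwIterates f₁ f₂ N α t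
    (fun i =>
      let v₁ := weightedAverage (N.nbr₁ t i) (N.W₁ t i) x.1
      let u₂ := weightedAverage (N.nbr₁₂ t i) (N.W₁₂ t i) x.2
      mwStep (α t) (fun p => mixedCost (f₁ i) (Pi.single p 1) u₂) v₁,
     fun i =>
      let v₂ := weightedAverage (N.nbr₂ t i) (N.W₂ t i) x.2
      let u₁ := weightedAverage (N.nbr₂₁ t i) (N.W₂₁ t i) x.1
      mwStep (α t) (fun q => mixedCost (f₂ i) u₁ (Pi.single q 1)) v₂)

end Algorithm

end SubnetworkGame

end

open Filter Topology

/-! An interior equilibrium trivializes the game but not the dynamics. Near such a point `(x₁, x₂)`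
the profiles `(z₁, x₂)`, `(x₁, z₂)` and `(z₁, z₂)` are all equilibria, which forces equal values of
the cost; by bilinearity the cost is then constant on all mixed profiles
(`globalCost_eq_of_isInteriorPoint`). Hence every profile is an equilibrium, and it remains to show
that the estimates in each subnetwork converge to a common limit.

A multiplicative-weights step is an average perturbed by `O(α)`. Joint connectivity contracts the
spread of the estimates over windows of fixed length, so the spread `E` is square-summable along
with `α` (`IsMixing.exists_spread_bound`).

Doubly stochastic weights preserve the sum of the estimates, so only the gradient terms move it. To
first order these are replicator directions. Evaluated at one common pair of strategies they cancel
in the sum over agents, because the summed gradient is the same for every action. The sum therefore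
moves by `O(α² + α E)`, which is summable, so it converges; consensus carries this over to each
agent (`IsMWTrajectory.exists_tendsto`). -/

/-- A nonnegative sequence which contracts over windows of fixed length, up to a summable error,
is summable. -/
theorem summable_of_window_contraction {a b : ℕ → ℝ} {ρ : ℝ} (L : ℕ) (hρ : ρ < 1)
    (ha : ∀ k, 0 ≤ a k) (hb : ∀ k, 0 ≤ b k) (hbs : Summable b)
    (h : ∀ k, a (k + L) ≤ ρ * a k + b k) : Summable a := by
  refine summable_of_sum_range_le (c := (∑ k ∈ Finset.range L, a k + ∑' k, b k) / (1 - ρ)) ha ?_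
  intro T
  rw [le_div_iff₀ (by linarith)]
  -- Extending the sum to `L + T` terms and shifting by `L` puts the same partial sum on both sides,
  -- with factor `ρ < 1` on the right.
  have h1 : ∑ k ∈ Finset.range T, a k ≤ ∑ k ∈ Finset.range (L + T), a k :=
    Finset.sum_le_sum_of_subset_of_nonneg (Finset.range_mono (by omega)) fun i _ _ => ha i
  rw [Finset.sum_range_add] at h1
  have h2 : ∑ k ∈ Finset.range T, a (L + k) ≤
      ρ * ∑ k ∈ Finset.range T, a k + ∑ k ∈ Finset.range T, b k := by
    rw [Finset.mul_sum, ← Finset.sum_add_distrib]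
    exact Finset.sum_le_sum fun k _ => by rw [add_comm L k]; exact h k
  have h3 := hbs.sum_le_tsum (Finset.range T) fun k _ => hb k
  linarith

/-! ### Consensus for perturbed averaging over jointly connected digraphs -/

section Consensus

variable {V : Type*}

/-- If the union of a family of digraphs is strongly connected, some edge of one of them leaves
any given nonempty proper set of vertices. -/
theorem exists_adj_of_iSup_stronglyConnected {G : ℕ → Digraph V} {T : Set ℕ}
    (hG : (⨆ t ∈ T, G t).StronglyConnected) {R : Set V} {a b : V} (ha : a ∈ R) (hb : b ∉ R) :
    ∃ t ∈ T, ∃ i ∈ R, ∃ j ∉ R, (G t).Adj i j := by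
  -- If no edge leaves `R`, membership in `R` propagates along a path from `a` to `b`.
  by_contra! hcon
  refine hb ?_
  clear hb
  induction hG a b with
  | refl => exact ha
  | @tail c d _ hadj ih =>
    by_contra hd
    simp only [Digraph.iSup_adj] at hadj
    obtain ⟨t, ht, hadj⟩ := hadj
    exact hcon t ht c ih d hd hadj

variable [Fintype V]

/-- Time-varying row-stochastic weights, positive along the edges of a uniformly jointly strongly
connected sequence of digraphs with self-loops. -/
structure IsMixing (G : ℕ → Digraph V) (W : ℕ → Matrix V V ℝ) (η : ℝ) : Prop where
  connected : UniformlyJointlyStronglyConnected G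
  pos : 0 < η
  lt_one : η < 1
  self : ∀ k i, (G k).Adj i i
  lower : ∀ k i j, (G k).Adj j i → η ≤ W k i j
  nonneg : ∀ k i j, 0 ≤ W k i j
  row_sum : ∀ k i, ∑ j, W k i j = 1

theorem sum_le_of_stochastic {w x : V → ℝ} {M : ℝ} (hw : ∀ j, 0 ≤ w j) (hw1 : ∑ j, w j = 1)
    (hx : ∀ j, x j ≤ M) : ∑ j, w j * x j ≤ M := by
  calc ∑ j, w j * x j ≤ ∑ j, w j * M :=
        Finset.sum_le_sum fun j _ => mul_le_mul_of_nonneg_left (hx j) (hw j)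
    _ = M := by rw [← Finset.sum_mul, hw1, one_mul]

theorem le_sum_of_stochastic {w x : V → ℝ} {m : ℝ} (hw : ∀ j, 0 ≤ w j) (hw1 : ∑ j, w j = 1)
    (hx : ∀ j, m ≤ x j) : m ≤ ∑ j, w j * x j := by
  calc m = ∑ j, w j * m := by rw [← Finset.sum_mul, hw1, one_mul]
    _ ≤ _ := Finset.sum_le_sum fun j _ => mul_le_mul_of_nonneg_left (hx j) (hw j)

theorem abs_sum_sub_le_of_stochastic {w x : V → ℝ} {c E : ℝ} (hw : ∀ j, 0 ≤ w j)
    (hw1 : ∑ j, w j = 1) (hx : ∀ j, |x j - c| ≤ E) : |∑ j, w j * x j - c| ≤ E := by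
  have h1 := le_sum_of_stochastic (x := x) (m := c - E) hw hw1 fun j => by linarith [(abs_le.1 (hx j)).1]
  have h2 := sum_le_of_stochastic (x := x) (M := c + E) hw hw1 fun j => by linarith [(abs_le.1 (hx j)).2]
  exact abs_le.2 ⟨by linarith, by linarith⟩

/-- A stochastic average is bounded away from the upper bound `M` if one of the averaged values
is, and has a weight at least `η`. -/
theorem sum_le_sub_of_stochastic {w x : V → ℝ} {M η d : ℝ} (hw : ∀ j, 0 ≤ w j)
    (hw1 : ∑ j, w j = 1) (hx : ∀ j, x j ≤ M) (hd : 0 ≤ d) {j : V} (hj : η ≤ w j)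
    (hxj : x j ≤ M - d) : ∑ j, w j * x j ≤ M - η * d := by
  have h1 : w j * (M - x j) ≤ ∑ i, w i * (M - x i) :=
    Finset.single_le_sum (f := fun i => w i * (M - x i))
      (fun i _ => mul_nonneg (hw i) (by linarith [hx i])) (Finset.mem_univ j)
  have h2 : ∑ i, w i * (M - x i) = M - ∑ i, w i * x i := by
    simp only [mul_sub, Finset.sum_sub_distrib]
    rw [← Finset.sum_mul, hw1, one_mul]
  have h3 : η * d ≤ w j * (M - x j) :=
    mul_le_mul hj (by linarith) hd (hw j)
  linarith

namespace IsMixing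

variable {G : ℕ → Digraph V} {W : ℕ → Matrix V V ℝ} {η : ℝ}

/-- Over a window whose length does not depend on its start, averaging pulls all values away from
their upper bound by a fixed fraction of the gap to any initial value. -/
theorem exists_window_contraction (h : IsMixing G W η) :
    ∃ L : ℕ, ∀ (k : ℕ) (z : ℕ → V → ℝ), (∀ t i, z (t + 1) i = ∑ j, W (k + t) i j * z t j) →
      ∀ M : ℝ, (∀ i, z 0 i ≤ M) → ∀ i j, z L i ≤ M - η ^ L * (M - z 0 j) := by
  classical
  obtain ⟨B, hB, hconn⟩ := h.connected
  refine ⟨Fintype.card V * B, fun k z hz M hM i j => ?_⟩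
  have hle : ∀ t i, z t i ≤ M := by
    intro t
    induction t with
    | zero => exact hM
    | succ t ih =>
      intro i
      rw [hz]
      exact sum_le_of_stochastic (h.nonneg _ _) (h.row_sum _ _) ih
  set d := M - z 0 j with hd
  have hd0 : 0 ≤ d := by linarith [hM j]
  -- Vertices already pulled below `M` by at least `η ^ t * d`. Each edge, self-loops included,
  -- costs one factor `η`, so `R` never loses a vertex; connectivity of a window makes it gain one
  -- until it is everything.
  set R : ℕ → Finset V := fun t => Finset.univ.filter fun i => z t i ≤ M - η ^ t * d with hR
  have hmem : ∀ t i, i ∈ R t ↔ z t i ≤ M - η ^ t * d := by simp [hR]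
  have hstep : ∀ t a b, a ∈ R t → (G (k + t)).Adj a b → b ∈ R (t + 1) := by
    intro t a b ha hab
    rw [hmem] at ha ⊢
    rw [hz, pow_succ', mul_assoc]
    exact sum_le_sub_of_stochastic (h.nonneg _ _) (h.row_sum _ _) (hle t)
      (mul_nonneg (pow_nonneg h.pos.le _) hd0) (h.lower _ _ _ hab) ha
  have hmono : Monotone R :=
    monotone_nat_of_le_succ fun t a ha => hstep t a a ha (h.self _ _)
  have hj : ∀ t, j ∈ R t := fun t => hmono (Nat.zero_le t) ((hmem 0 j).2 (by simp [hd]))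
  have hgrow : ∀ t, R t ≠ Finset.univ → (R t).card + 1 ≤ (R (t + B)).card := by
    intro t ht
    obtain ⟨b, hb⟩ : ∃ b, b ∉ R t := by
      by_contra! hcon
      exact ht (Finset.eq_univ_iff_forall.2 hcon)
    obtain ⟨s, hs, a, ha, c, hc, hac⟩ :=
      exists_adj_of_iSup_stronglyConnected (R := (R t : Set V)) (hconn (k + t)) (hj t) hb
    obtain ⟨u, rfl⟩ := Nat.exists_eq_add_of_le hs.1
    have hcu : c ∈ R (t + u + 1) :=
      hstep (t + u) a c (hmono (by omega) ha) (by rw [← add_assoc]; exact hac)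
    have hcB : c ∈ R (t + B) := hmono (by have := hs.2; omega) hcu
    exact Finset.card_lt_card ((Finset.ssubset_iff_of_subset (hmono (by omega))).2 ⟨c, hcB, hc⟩)
  have hcard : ∀ n, R (n * B) = Finset.univ ∨ n + 1 ≤ (R (n * B)).card := by
    intro n
    induction n with
    | zero => exact Or.inr (Finset.card_pos.2 ⟨j, hj _⟩)
    | succ n ih =>
      rw [Nat.succ_mul]
      by_cases hu : R (n * B) = Finset.univ
      · exact Or.inl (Finset.eq_univ_iff_forall.2 fun a =>
          hmono (Nat.le_add_right _ _) (hu ▸ Finset.mem_univ a))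
      · exact Or.inr (by have := hgrow _ hu; have := ih.resolve_left hu; omega)
  -- After `card V` windows the counting alternative would need `card V + 1` vertices.
  have huniv : R (Fintype.card V * B) = Finset.univ :=
    (hcard _).resolve_right (by have := Finset.card_le_univ (R (Fintype.card V * B)); omega)
  exact (hmem _ _).1 (huniv ▸ Finset.mem_univ i)

/-- Consensus: if the values are averaged at each time up to an antitone square-summable error,
then their spread is square-summable. -/
theorem exists_spread_bound [Nonempty V] (h : IsMixing G W η) {y : ℕ → V → ℝ} {r : ℕ → ℝ}
    (hanti : Antitone r) (hsq : Summable fun t => r t ^ 2)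
    (hy : ∀ t i, |y (t + 1) i - ∑ j, W t i j * y t j| ≤ r t) :
    ∃ D : ℕ → ℝ, (∀ t, 0 ≤ D t) ∧ (Summable fun t => D t ^ 2) ∧
      ∀ t i j, |y t i - y t j| ≤ D t := by
  obtain ⟨L, hL⟩ := h.exists_window_contraction
  choose p hp using fun t => Finite.exists_max (y t)
  choose q hq using fun t => Finite.exists_min (y t)
  have hD0 : ∀ t, 0 ≤ y t (p t) - y t (q t) := fun t => sub_nonneg.2 (hp t _)
  refine ⟨fun t => y t (p t) - y t (q t), hD0, ?_, fun t i j => abs_le.2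
    ⟨by linarith [hp t j, hq t i], by linarith [hp t i, hq t j]⟩⟩
  set δ := η ^ L with hδ
  have hδ0 : 0 < δ := pow_pos h.pos L
  have hδ1 : δ ≤ 1 := pow_le_one₀ h.pos.le h.lt_one.le
  have hrec : ∀ k, y (k + L) (p (k + L)) - y (k + L) (q (k + L)) ≤
      (1 - δ) * (y k (p k) - y k (q k)) + 2 * L * r k := by
    intro k
    -- The error-free averaging started from `y k`; since `r` is antitone, `y` drifts from it by at
    -- most `r k` per step.
    let z : ℕ → V → ℝ := fun t => Nat.rec (y k) (fun t v i => ∑ j, W (k + t) i j * v j) t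
    have hz : ∀ t i, z (t + 1) i = ∑ j, W (k + t) i j * z t j := fun t i => rfl
    have hz0 : z 0 = y k := rfl
    have hge : ∀ t i, y k (q k) ≤ z t i := by
      intro t
      induction t with
      | zero => exact hq k
      | succ t ih =>
        intro i
        rw [hz]
        exact le_sum_of_stochastic (h.nonneg _ _) (h.row_sum _ _) ih
    have hclose : ∀ t i, |y (k + t) i - z t i| ≤ t * r k := by
      intro t
      induction t with
      | zero => intro i; simp [hz0]
      | succ t ih =>
        intro i
        have h1 := hy (k + t) i
        have h2 : |∑ j, W (k + t) i j * (y (k + t) j - z t j) - 0| ≤ t * r k :=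
          abs_sum_sub_le_of_stochastic (h.nonneg _ _) (h.row_sum _ _)
            fun j => by simpa using ih j
        have h3 : ∑ j, W (k + t) i j * (y (k + t) j - z t j) =
            ∑ j, W (k + t) i j * y (k + t) j - z (t + 1) i := by
          simp only [mul_sub, Finset.sum_sub_distrib, hz]
        rw [sub_zero, h3] at h2
        have h4 : r (k + t) ≤ r k := hanti (Nat.le_add_right _ _)
        rw [← add_assoc]
        push_cast
        rw [abs_le] at h1 h2 ⊢
        constructor <;> linarith [h1.1, h1.2, h2.1, h2.2]
    -- The maximum of `z L` has dropped by `δ` times the old spread, while its minimum is no lower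
    -- than before; the drift enters twice, hence `2 * L * r k`.
    have h1 := hL k z hz (y k (p k)) (hp k) (p (k + L)) (q k)
    have h2 := abs_le.1 (hclose L (p (k + L)))
    have h3 := abs_le.1 (hclose L (q (k + L)))
    have h4 := hge L (q (k + L))
    rw [hz0] at h1
    linarith [h2.2, h3.1]
  -- Convexity of the square with weights `1 - δ` and `δ`: the squared right side of `hrec` is at
  -- most `(1 - δ) * D ^ 2 + δ * (2 * L * r k / δ) ^ 2`.
  refine summable_of_window_contraction (ρ := 1 - δ) (b := fun k => (2 * L) ^ 2 / δ * r k ^ 2) L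
    (by linarith) (fun k => sq_nonneg _) (fun k => by positivity) (hsq.mul_left _) fun k => ?_
  have h1 := pow_le_pow_left₀ (hD0 (k + L)) (hrec k) 2
  refine h1.trans ?_
  beta_reduce
  generalize y k (p k) - y k (q k) = D
  have h2 : (1 - δ) * D ^ 2 + (2 * L) ^ 2 / δ * r k ^ 2 - ((1 - δ) * D + 2 * L * r k) ^ 2 =
      (1 - δ) / δ * (δ * D - 2 * L * r k) ^ 2 := by
    field_simp
    ring
  have h3 : 0 ≤ (1 - δ) / δ * (δ * D - 2 * L * r k) ^ 2 :=
    mul_nonneg (div_nonneg (by linarith) hδ0.le) (sq_nonneg _)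
  linarith

end IsMixing

end Consensus

/-- The factor `exp |x|` makes the second-order remainder bound global, so no smallness of the
step-size is needed later. -/
theorem exp_sub_one_sub_id_le_mul_exp_abs (x : ℝ) :
    |Real.exp x - 1 - x| ≤ x ^ 2 * Real.exp |x| := by
  have h := Complex.norm_exp_sub_sum_le_norm_mul_exp (x : ℂ) 2
  simp only [Finset.sum_range_succ, Finset.sum_range_zero, Nat.factorial] at h
  have h1 : Complex.exp (x : ℂ) - (0 + (x : ℂ) ^ 0 / ((1 : ℕ) : ℂ)
      + (x : ℂ) ^ 1 / (((0 + 1) * 1 : ℕ) : ℂ)) = ((Real.exp x - 1 - x : ℝ) : ℂ) := by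
    push_cast
    ring
  rw [h1, Complex.norm_real, Complex.norm_real, Real.norm_eq_abs, Real.norm_eq_abs, sq_abs] at h
  exact h

theorem exists_forall_abs_le {V A B : Type*} [Finite V] [Finite A] [Finite B]
    (h : V → A → B → ℝ) : ∃ F : ℝ, 0 ≤ F ∧ ∀ i p q, |h i p q| ≤ F := by
  obtain ⟨F, hF⟩ := (Set.finite_range fun s : V × A × B => |h s.1 s.2.1 s.2.2|).bddAbove
  exact ⟨max F 0, le_max_right _ _, fun i p q =>
    (hF ⟨(i, p, q), rfl⟩).trans (le_max_left _ _)⟩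

theorem abs_sum_mul_le {A : Type*} [Fintype A] {v g : A → ℝ} {F : ℝ} (hv : v ∈ stdSimplex ℝ A)
    (hg : ∀ p, |g p| ≤ F) : |∑ p, v p * g p| ≤ F := by
  simpa using abs_sum_sub_le_of_stochastic (c := 0) hv.1 hv.2 (x := g) (by simpa using hg)

theorem average_mem_stdSimplex {V A : Type*} [Fintype V] [Fintype A] {w : V → ℝ} {x : V → A → ℝ}
    (hw : w ∈ stdSimplex ℝ V) (hx : ∀ i, x i ∈ stdSimplex ℝ A) :
    (fun p => ∑ j, w j * x j p) ∈ stdSimplex ℝ A := by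
  refine ⟨fun p => Finset.sum_nonneg fun j _ => mul_nonneg (hw.1 j) ((hx j).1 p), ?_⟩
  rw [Finset.sum_comm]
  simp only [← Finset.mul_sum, (hx _).2, mul_one, hw.2]

namespace SubnetworkGame

/-! ### First-order analysis of one multiplicative-weights step -/

section Step

variable {A : Type*} [Fintype A]

theorem mwStep_normalizer_pos {a : ℝ} {g v : A → ℝ} (hv : v ∈ stdSimplex ℝ A) :
    0 < ∑ k, v k * Real.exp (-a * g k) := by
  obtain ⟨p, hp⟩ : ∃ p, v p ≠ 0 := by
    by_contra! hcon
    have := hv.2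
    simp [hcon] at this
  exact Finset.sum_pos' (fun k _ => mul_nonneg (hv.1 k) (Real.exp_pos _).le)
    ⟨p, Finset.mem_univ _, mul_pos (lt_of_le_of_ne (hv.1 p) hp.symm) (Real.exp_pos _)⟩

theorem mwStep_mem_stdSimplex {a : ℝ} {g v : A → ℝ} (hv : v ∈ stdSimplex ℝ A) :
    mwStep a g v ∈ stdSimplex ℝ A := by
  have hZ := mwStep_normalizer_pos (a := a) (g := g) hv
  refine ⟨fun p => div_nonneg (mul_nonneg (hv.1 p) (Real.exp_pos _).le) hZ.le, ?_⟩
  simp only [mwStep]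
  rw [← Finset.sum_div, div_self hZ.ne']

/-- To first order in the step-size, a multiplicative-weights step is a replicator step. -/
theorem exists_mwStep_expansion {F a₀ : ℝ} (hF : 0 ≤ F) (ha₀ : 0 ≤ a₀) :
    ∃ C : ℝ, 0 ≤ C ∧ ∀ (a : ℝ) (g v : A → ℝ), 0 ≤ a → a ≤ a₀ → v ∈ stdSimplex ℝ A →
      (∀ p, |g p| ≤ F) → ∀ p,
        |mwStep a g v p - v p + a * (v p * (g p - ∑ k, v k * g k))| ≤ C * a ^ 2 := by
  set K := F ^ 2 * Real.exp (a₀ * F) with hK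
  have hK0 : 0 ≤ K := by positivity
  -- The bracket bounds the numerator of the exact error in `hident`; the exponential bounds `1 /
  -- Z`.
  refine ⟨(2 * F * (F + K * a₀) + 2 * K) * Real.exp (a₀ * F), by positivity, ?_⟩
  intro a g v ha haa hv hg p
  have hag : ∀ k, |-a * g k| ≤ a₀ * F := fun k => by
    rw [abs_mul, abs_neg, abs_of_nonneg ha]
    exact mul_le_mul haa (hg k) (abs_nonneg _) ha₀
  set θ : A → ℝ := fun k => Real.exp (-a * g k) - 1 - -a * g k with hθ
  have hθK : ∀ k, |θ k| ≤ K * a ^ 2 := fun k => by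
    refine (exp_sub_one_sub_id_le_mul_exp_abs (-a * g k)).trans ?_
    have h1 : (-a * g k) ^ 2 ≤ F ^ 2 * a ^ 2 := by
      have := pow_le_pow_left₀ (abs_nonneg _) (hg k) 2
      rw [sq_abs] at this
      nlinarith [mul_le_mul_of_nonneg_right this (sq_nonneg a)]
    calc (-a * g k) ^ 2 * Real.exp |-a * g k| ≤ (F ^ 2 * a ^ 2) * Real.exp (a₀ * F) :=
          mul_le_mul h1 (Real.exp_le_exp.2 (hag k)) (Real.exp_pos _).le (by positivity)
      _ = K * a ^ 2 := by rw [hK]; ring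
  set Z := ∑ k, v k * Real.exp (-a * g k) with hZ
  set gm := ∑ k, v k * g k with hgm
  set θm := ∑ k, v k * θ k with hθm
  have hZexp : Z = 1 - a * gm + θm := by
    have : ∀ k, v k * Real.exp (-a * g k) = v k - a * (v k * g k) + v k * θ k := fun k => by
      simp only [hθ]
      ring
    rw [hZ, Finset.sum_congr rfl fun k _ => this k, Finset.sum_add_distrib,
      Finset.sum_sub_distrib, ← Finset.mul_sum, hv.2]
  have hgmF : |gm| ≤ F := abs_sum_mul_le hv hg
  have hθmK : |θm| ≤ K * a ^ 2 := abs_sum_mul_le hv hθK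
  have hZlow : Real.exp (-(a₀ * F)) ≤ Z :=
    le_sum_of_stochastic hv.1 hv.2 fun k =>
      Real.exp_le_exp.2 (by linarith [neg_abs_le (-a * g k), hag k])
  have hZ0 : 0 < Z := (Real.exp_pos _).trans_le hZlow
  -- All first-order terms cancel; what is left is quadratic in `a`, since `Z - 1 = O(a)` and `θ =
  -- O(a²)`.
  have hident : mwStep a g v p - v p + a * (v p * (g p - gm)) =
      v p * (a * (g p - gm) * (Z - 1) + (θ p - θm)) / Z := by
    have h1 : Real.exp (-a * g p) = 1 - a * g p + θ p := by simp only [hθ]; ring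
    simp only [mwStep]
    rw [← hZ, h1, eq_div_iff hZ0.ne', add_mul, sub_mul, div_mul_cancel₀ _ hZ0.ne']
    rw [hZexp]
    ring
  have hvp1 : v p ≤ 1 := by
    rw [← hv.2]
    exact Finset.single_le_sum (fun k _ => hv.1 k) (Finset.mem_univ p)
  have hnum : |a * (g p - gm) * (Z - 1) + (θ p - θm)| ≤
      (2 * F * (F + K * a₀) + 2 * K) * a ^ 2 := by
    have h1 : |g p - gm| ≤ 2 * F := (abs_sub _ _).trans (by linarith [hg p])
    have h2 : |Z - 1| ≤ (F + K * a₀) * a := by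
      have : Z - 1 = -(a * gm) + θm := by rw [hZexp]; ring
      rw [this]
      refine (abs_add_le _ _).trans ?_
      rw [abs_neg, abs_mul, abs_of_nonneg ha]
      have h3 : K * a ^ 2 ≤ K * a₀ * a := by
        rw [pow_two, ← mul_assoc]
        exact mul_le_mul_of_nonneg_right (mul_le_mul_of_nonneg_left haa hK0) ha
      nlinarith [mul_le_mul_of_nonneg_left hgmF ha]
    have h3 : |a * (g p - gm) * (Z - 1)| ≤ a * (2 * F) * ((F + K * a₀) * a) := by
      rw [abs_mul, abs_mul, abs_of_nonneg ha]
      exact mul_le_mul (mul_le_mul_of_nonneg_left h1 ha) h2 (abs_nonneg _) (by positivity)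
    have h4 : |θ p - θm| ≤ 2 * K * a ^ 2 := (abs_sub _ _).trans (by linarith [hθK p])
    refine (abs_add_le _ _).trans ?_
    linarith
  rw [hident, abs_div, abs_of_pos hZ0, div_le_iff₀ hZ0, abs_mul, abs_of_nonneg (hv.1 p)]
  have hone : 1 ≤ Real.exp (a₀ * F) * Z := by
    have := mul_le_mul_of_nonneg_left hZlow (Real.exp_pos (a₀ * F)).le
    rwa [← Real.exp_add, add_neg_cancel, Real.exp_zero] at this
  have hCpos : 0 ≤ (2 * F * (F + K * a₀) + 2 * K) * a ^ 2 := by positivity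
  calc v p * |a * (g p - gm) * (Z - 1) + (θ p - θm)|
      ≤ 1 * |a * (g p - gm) * (Z - 1) + (θ p - θm)| :=
        mul_le_mul_of_nonneg_right hvp1 (abs_nonneg _)
    _ ≤ (2 * F * (F + K * a₀) + 2 * K) * a ^ 2 := by rw [one_mul]; exact hnum
    _ ≤ (2 * F * (F + K * a₀) + 2 * K) * a ^ 2 * (Real.exp (a₀ * F) * Z) :=
        le_mul_of_one_le_right hCpos hone
    _ = _ := by ring

/-- The replicator direction is Lipschitz in the mixed strategy and the gradient. -/
theorem abs_replicator_sub_le {v v' g g' : A → ℝ} {F E H : ℝ}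
    (hv : v ∈ stdSimplex ℝ A) (hv' : v' ∈ stdSimplex ℝ A) (hg : ∀ p, |g p| ≤ F)
    (hvv : ∀ p, |v p - v' p| ≤ E) (hgg : ∀ p, |g p - g' p| ≤ H) (p : A) :
    |v p * (g p - ∑ k, v k * g k) - v' p * (g' p - ∑ k, v' k * g' k)| ≤
      (2 + Fintype.card A) * F * E + 2 * H := by
  have hE : 0 ≤ E := (abs_nonneg _).trans (hvv p)
  have h1 : |∑ k, (v k - v' k) * g k| ≤ Fintype.card A * F * E := by
    refine (Finset.abs_sum_le_sum_abs _ _).trans ?_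
    have : ∀ k ∈ Finset.univ, |(v k - v' k) * g k| ≤ E * F := fun k _ => by
      rw [abs_mul]
      exact mul_le_mul (hvv k) (hg k) (abs_nonneg _) hE
    refine (Finset.sum_le_card_nsmul _ _ _ this).trans (le_of_eq ?_)
    rw [Finset.card_univ, nsmul_eq_mul]
    ring
  have h2 : |∑ k, v' k * (g k - g' k)| ≤ H := abs_sum_mul_le hv' hgg
  have h3 : |g p - ∑ k, v k * g k| ≤ 2 * F :=
    (abs_sub _ _).trans (by linarith [hg p, abs_sum_mul_le hv hg])
  have h4 : |(v p - v' p) * (g p - ∑ k, v k * g k)| ≤ E * (2 * F) := by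
    rw [abs_mul]
    exact mul_le_mul (hvv p) h3 (abs_nonneg _) hE
  have hvp1 : v' p ≤ 1 := by
    rw [← hv'.2]
    exact Finset.single_le_sum (fun k _ => hv'.1 k) (Finset.mem_univ p)
  -- The change of `g p` minus its mean, the change of the mean being split into the effect of `v`
  -- and that of `g`.
  set S := (g p - g' p) - (∑ k, (v k - v' k) * g k + ∑ k, v' k * (g k - g' k)) with hS
  have h5 : |S| ≤ H + (Fintype.card A * F * E + H) :=
    (abs_sub _ _).trans (add_le_add (hgg p) ((abs_add_le _ _).trans (add_le_add h1 h2)))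
  have h6 : |v' p * S| ≤ H + (Fintype.card A * F * E + H) := by
    rw [abs_mul, abs_of_nonneg (hv'.1 p)]
    exact (mul_le_of_le_one_left (abs_nonneg _) hvp1).trans h5
  have hid : v p * (g p - ∑ k, v k * g k) - v' p * (g' p - ∑ k, v' k * g' k) =
      (v p - v' p) * (g p - ∑ k, v k * g k) + v' p * S := by
    simp only [hS, sub_mul, mul_sub, Finset.sum_sub_distrib]
    ring
  rw [hid]
  refine (abs_add_le _ _).trans ((add_le_add h4 h6).trans (le_of_eq ?_))
  ring

end Step

end SubnetworkGame

namespace SubnetworkGame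

/-! ### Consensus and convergence inside one subnetwork -/

section Population

variable {V A B : Type*} [Fintype V] [Fintype A] [Fintype B]

/-- The estimates `x` of the agents of one subnetwork, running multiplicative weights with the
received estimates `u` of the strategy of the other one. -/
structure IsMWTrajectory (h : V → A → B → ℝ) (W : ℕ → Matrix V V ℝ) (α : ℕ → ℝ)
    (u : ℕ → V → B → ℝ) (x : ℕ → V → A → ℝ) : Prop where
  mem : ∀ t i, x t i ∈ stdSimplex ℝ A
  recv_mem : ∀ t i, u t i ∈ stdSimplex ℝ B
  step : ∀ t i, x (t + 1) i =
    mwStep (α t) (fun p => ∑ q, u t i q * h i p q) (fun p => ∑ j, W t i j * x t j p)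

namespace IsMWTrajectory

variable {h : V → A → B → ℝ} {G : ℕ → Digraph V} {W : ℕ → Matrix V V ℝ} {η : ℝ} {α : ℕ → ℝ}
  {u : ℕ → V → B → ℝ} {x : ℕ → V → A → ℝ}

theorem average_mem (hx : IsMWTrajectory h W α u x) (hW : IsMixing G W η) (t : ℕ) (i : V) :
    (fun p => ∑ j, W t i j * x t j p) ∈ stdSimplex ℝ A :=
  average_mem_stdSimplex ⟨hW.nonneg t i, hW.row_sum t i⟩ (hx.mem t)

/-- The agents reach consensus, at a square-summable rate. -/
theorem exists_spread_bound [Nonempty V] (hx : IsMWTrajectory h W α u x) (hW : IsMixing G W η)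
    (hα : ∀ t, 0 < α t) (hanti : Antitone α) (hsq : Summable fun t => α t ^ 2) :
    ∃ E : ℕ → ℝ, (∀ t, 0 ≤ E t) ∧ (Summable fun t => E t ^ 2) ∧
      ∀ t i j p, |x t i p - x t j p| ≤ E t := by
  obtain ⟨F, hF, hhF⟩ := exists_forall_abs_le h
  obtain ⟨C, hC, hexp⟩ := exists_mwStep_expansion (A := A) hF (hα 0).le
  -- `C * α 0` absorbs the quadratic remainder through `α t ≤ α 0`, and `2 * F` bounds the
  -- replicator term.
  have hpert : ∀ p t i, |x (t + 1) i p - ∑ j, W t i j * x t j p| ≤ (C * α 0 + 2 * F) * α t := by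
    intro p t i
    have hv := hx.average_mem hW t i
    have hg : ∀ p, |∑ q, u t i q * h i p q| ≤ F :=
      fun p => abs_sum_mul_le (hx.recv_mem t i) (hhF i p)
    have h0 := hanti (Nat.zero_le t)
    have h1 := hexp (α t) _ _ (hα t).le h0 hv hg p
    rw [← hx.step] at h1
    have hm := abs_sum_mul_le hv hg
    beta_reduce at h1 hm
    set g := ∑ q, u t i q * h i p q with hgdef
    set gm := ∑ k, (∑ j, W t i j * x t j k) * ∑ q, u t i q * h i k q
    set v := ∑ j, W t i j * x t j p
    have hv0 : 0 ≤ v := hv.1 p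
    have hv1 : v ≤ 1 := by
      rw [← hv.2]
      exact Finset.single_le_sum (fun k _ => hv.1 k) (Finset.mem_univ p)
    have h2 : |α t * (v * (g - gm))| ≤ α t * (2 * F) := by
      rw [abs_mul, abs_mul, abs_of_pos (hα t), abs_of_nonneg hv0]
      exact mul_le_mul_of_nonneg_left ((mul_le_of_le_one_left (abs_nonneg _) hv1).trans
        ((abs_sub _ _).trans (by linarith [hg p]))) (hα t).le
    have h3 : C * α t ^ 2 ≤ C * α 0 * α t := by
      rw [pow_two, ← mul_assoc]
      exact mul_le_mul_of_nonneg_right (mul_le_mul_of_nonneg_left h0 hC) (hα t).le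
    rw [abs_le] at h1 h2 ⊢
    constructor <;> linarith [h1.1, h1.2, h2.1, h2.2]
  have hR : 0 ≤ C * α 0 + 2 * F := add_nonneg (mul_nonneg hC (hα 0).le) (by linarith)
  -- Consensus is applied to each action's coordinate; summing the spreads gives one bound for all,
  -- square-summable by Cauchy–Schwarz.
  choose D hD0 hDs hD using fun p => hW.exists_spread_bound (y := fun t i => x t i p)
    (fun s t hst => mul_le_mul_of_nonneg_left (hanti hst) hR)
    (by simpa only [mul_pow] using hsq.mul_left _) (hpert p)
  refine ⟨fun t => ∑ p, D p t, fun t => Finset.sum_nonneg fun p _ => hD0 p t, ?_, fun t i j p =>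
    (hD p t i j).trans (Finset.single_le_sum (f := fun p => D p t) (fun k _ => hD0 k t)
      (Finset.mem_univ p))⟩
  refine Summable.of_nonneg_of_le (fun t => sq_nonneg _) (fun t => sq_sum_le_card_mul_sum_sq)
    (Summable.mul_left _ (summable_sum fun p _ => hDs p))

/-- If the average cost is constant, the estimates of all agents converge to a common limit. -/
theorem exists_tendsto [Nonempty V] (hx : IsMWTrajectory h W α u x) (hW : IsMixing G W η)
    (hcol : ∀ t j, ∑ i, W t i j = 1) (hα : ∀ t, 0 < α t) (hanti : Antitone α)
    (hsq : Summable fun t => α t ^ 2) {c : ℝ} (hc : ∀ p q, ∑ i, h i p q = c)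
    {E : ℕ → ℝ} (hEs : Summable fun t => E t ^ 2) (hE : ∀ t i j p, |x t i p - x t j p| ≤ E t)
    {b : ℕ → B → ℝ} (hb : ∀ t, b t ∈ stdSimplex ℝ B) (hub : ∀ t i q, |u t i q - b t q| ≤ E t) :
    ∃ l ∈ stdSimplex ℝ A, ∀ i, Tendsto (fun t => x t i) atTop (𝓝 l) := by
  obtain ⟨F, hF, hhF⟩ := exists_forall_abs_le h
  obtain ⟨C, hC, hexp⟩ := exists_mwStep_expansion (A := A) hF (hα 0).le
  obtain ⟨i₀⟩ := ‹Nonempty V›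
  set n : ℝ := (Fintype.card V : ℝ) with hn
  have hn0 : 0 < n := Nat.cast_pos.2 (Fintype.card_pos_iff.2 ⟨i₀⟩)
  -- The constant of `abs_replicator_sub_le` with the gradient error `H = card B * F * E t`.
  set K : ℝ := (2 + Fintype.card A) * F + 2 * (Fintype.card B * F) with hK
  have hK0 : 0 ≤ K := by positivity
  have hstep : ∀ p t, |∑ i, x (t + 1) i p - ∑ i, x t i p| ≤
      n * (C * α t ^ 2 + K * (α t ^ 2 + E t ^ 2)) := by
    intro p t
    set v : V → A → ℝ := fun i p => ∑ j, W t i j * x t j p with hvdef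
    set g : V → A → ℝ := fun i p => ∑ q, u t i q * h i p q with hgdef
    set g' : V → A → ℝ := fun i p => ∑ q, b t q * h i p q with hg'def
    have hv : ∀ i, v i ∈ stdSimplex ℝ A := hx.average_mem hW t
    have hg : ∀ i p, |g i p| ≤ F := fun i p => abs_sum_mul_le (hx.recv_mem t i) (hhF i p)
    -- Unit column sums: mixing leaves the total unchanged.
    have hmean : ∑ i, v i p = ∑ i, x t i p := by
      simp only [hvdef]
      rw [Finset.sum_comm]
      simp only [← Finset.sum_mul, hcol, one_mul]
    have hg'sum : ∀ p, ∑ i, g' i p = c := by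
      intro p
      simp only [hg'def]
      rw [Finset.sum_comm]
      simp only [← Finset.mul_sum, hc]
      rw [← Finset.sum_mul, (hb t).2, one_mul]
    -- The key cancellation: at the common strategies `x t i₀` and `b t`, the summed gradient is `c`
    -- for every action, and so is its mean.
    have hrep : ∑ i, x t i₀ p * (g' i p - ∑ k, x t i₀ k * g' i k) = 0 := by
      rw [← Finset.mul_sum, Finset.sum_sub_distrib, hg'sum, Finset.sum_comm]
      simp only [← Finset.mul_sum, hg'sum]
      rw [← Finset.sum_mul, (hx.mem t i₀).2, one_mul, sub_self, mul_zero]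
    have hvx : ∀ i p, |v i p - x t i₀ p| ≤ E t := fun i p =>
      abs_sum_sub_le_of_stochastic (hW.nonneg t i) (hW.row_sum t i) fun j => hE t j i₀ p
    have hE0 : 0 ≤ E t := (abs_nonneg _).trans (hvx i₀ p)
    have hgg : ∀ i p, |g i p - g' i p| ≤ Fintype.card B * F * E t := by
      intro i p
      simp only [hgdef, hg'def]
      rw [← Finset.sum_sub_distrib]
      refine (Finset.abs_sum_le_sum_abs _ _).trans ?_
      have : ∀ q ∈ Finset.univ, |u t i q * h i p q - b t q * h i p q| ≤ E t * F := fun q _ => by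
        rw [← sub_mul, abs_mul]
        exact mul_le_mul (hub t i q) (hhF i p q) (abs_nonneg _) hE0
      refine (Finset.sum_le_card_nsmul _ _ _ this).trans (le_of_eq ?_)
      rw [Finset.card_univ, nsmul_eq_mul]
      ring
    have hlip : ∀ i, |v i p * (g i p - ∑ k, v i k * g i k) -
        x t i₀ p * (g' i p - ∑ k, x t i₀ k * g' i k)| ≤ K * E t := fun i =>
      (abs_replicator_sub_le (hv i) (hx.mem t i₀) (hg i) (hvx i) (hgg i) p).trans
        (le_of_eq (by rw [hK]; ring))
    have hterm : ∀ i ∈ Finset.univ, |x (t + 1) i p - v i p +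
        α t * (x t i₀ p * (g' i p - ∑ k, x t i₀ k * g' i k))| ≤
        C * α t ^ 2 + K * (α t ^ 2 + E t ^ 2) := by
      intro i _
      have h1 := hexp (α t) _ _ (hα t).le (hanti (Nat.zero_le t)) (hv i) (hg i) p
      rw [← hx.step t i] at h1
      have h2 : |α t * (v i p * (g i p - ∑ k, v i k * g i k) -
          x t i₀ p * (g' i p - ∑ k, x t i₀ k * g' i k))| ≤ K * (α t ^ 2 + E t ^ 2) := by
        rw [abs_mul, abs_of_pos (hα t)]
        refine (mul_le_mul_of_nonneg_left (hlip i) (hα t).le).trans ?_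
        rw [mul_left_comm]
        -- The cross term `α t * E t` is at most `α t ^ 2 + E t ^ 2`, which is summable.
        exact mul_le_mul_of_nonneg_left (by nlinarith [sq_nonneg (α t - E t), hα t]) hK0
      rw [abs_le] at h1 h2 ⊢
      constructor <;> linarith [h1.1, h1.2, h2.1, h2.2]
    have hsum := (Finset.abs_sum_le_sum_abs _ _).trans (Finset.sum_le_card_nsmul _ _ _ hterm)
    rw [Finset.sum_add_distrib, Finset.sum_sub_distrib, hmean, ← Finset.mul_sum, hrep, mul_zero,
      add_zero, Finset.card_univ, nsmul_eq_mul] at hsum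
    exact hsum
  have hconv : ∀ p, ∃ s, Tendsto (fun t => ∑ i, x t i p) atTop (𝓝 s) := fun p => by
    refine cauchySeq_tendsto_of_complete (cauchySeq_of_summable_dist ?_)
    refine Summable.of_nonneg_of_le (fun t => dist_nonneg)
      (fun t => by rw [dist_comm, Real.dist_eq]; exact hstep p t)
      (((hsq.mul_left C).add ((hsq.add hEs).mul_left K)).mul_left n)
  choose s hs using hconv
  have hEt : Tendsto E atTop (𝓝 0) := by
    have h1 := hEs.tendsto_atTop_zero.sqrt
    simp only [Real.sqrt_sq_eq_abs, Real.sqrt_zero] at h1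
    exact tendsto_zero_iff_abs_tendsto_zero E |>.2 h1
  have hlim : ∀ i, Tendsto (fun t => x t i) atTop (𝓝 fun p => s p / n) := by
    intro i
    refine tendsto_pi_nhds.2 fun p => ?_
    -- Each estimate lies within the spread of the population mean.
    have hdiff : Tendsto (fun t => x t i p - (∑ j, x t j p) / n) atTop (𝓝 0) := by
      refine squeeze_zero_norm (fun t => ?_) hEt
      have h1 : ∑ j, 1 / n * x t j p = (∑ j, x t j p) / n := by
        rw [← Finset.mul_sum]
        ring
      rw [Real.norm_eq_abs, abs_sub_comm, ← h1]
      refine abs_sum_sub_le_of_stochastic (fun _ => by positivity) ?_ fun j => hE t j i p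
      rw [Finset.sum_const, Finset.card_univ, nsmul_eq_mul, ← hn, mul_one_div_cancel hn0.ne']
    simpa using hdiff.add ((hs p).div_const n)
  exact ⟨_, (isClosed_stdSimplex ℝ A).mem_of_tendsto (hlim i₀)
    (Eventually.of_forall fun t => hx.mem t i₀), hlim⟩

end IsMWTrajectory

end Population

end SubnetworkGame

namespace SubnetworkGame

/-! ### Bilinearity and rigidity of the game -/

section Game

variable {V V₁ V₂ A₁ A₂ : Type*} [Fintype V] [Fintype V₁] [Fintype V₂] [Fintype A₁] [Fintype A₂]

/-- Viewing the global cost as one averaged cost matrix makes the bilinearity of `mixedCost`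
available for it. -/
theorem globalCost_eq_mixedCost (f : V → A₁ → A₂ → ℝ) (x₁ : A₁ → ℝ) (x₂ : A₂ → ℝ) :
    globalCost f x₁ x₂ =
      mixedCost (fun p q => (1 / (Fintype.card V : ℝ)) * ∑ i, f i p q) x₁ x₂ := by
  simp only [globalCost, mixedCost]
  rw [Finset.sum_comm, Finset.mul_sum]
  refine Finset.sum_congr rfl fun p _ => ?_
  rw [Finset.sum_comm, Finset.mul_sum]
  refine Finset.sum_congr rfl fun q _ => ?_
  rw [← Finset.mul_sum]
  ring

theorem mixedCost_combo_left (c : A₁ → A₂ → ℝ) (s : ℝ) (x y : A₁ → ℝ) (z : A₂ → ℝ) :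
    mixedCost c ((1 - s) • x + s • y) z = (1 - s) * mixedCost c x z + s * mixedCost c y z := by
  simp only [mixedCost, Finset.mul_sum, ← Finset.sum_add_distrib, Pi.add_apply, Pi.smul_apply,
    smul_eq_mul]
  exact Finset.sum_congr rfl fun p _ => Finset.sum_congr rfl fun q _ => by ring

theorem mixedCost_combo_right (c : A₁ → A₂ → ℝ) (s : ℝ) (z : A₁ → ℝ) (x y : A₂ → ℝ) :
    mixedCost c z ((1 - s) • x + s • y) = (1 - s) * mixedCost c z x + s * mixedCost c z y := by
  simp only [mixedCost, Finset.mul_sum, ← Finset.sum_add_distrib, Pi.add_apply, Pi.smul_apply,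
    smul_eq_mul]
  exact Finset.sum_congr rfl fun p _ => Finset.sum_congr rfl fun q _ => by ring

theorem mixedCost_single_left [DecidableEq A₁] (c : A₁ → A₂ → ℝ) (p : A₁) (y : A₂ → ℝ) :
    mixedCost c (Pi.single p 1) y = ∑ q, y q * c p q := by
  rw [mixedCost, Finset.sum_eq_single p (fun b _ hb => by simp [Pi.single_eq_of_ne hb]) (by simp)]
  simp

theorem mixedCost_single_right [DecidableEq A₂] (c : A₁ → A₂ → ℝ) (x : A₁ → ℝ) (q : A₂) :
    mixedCost c x (Pi.single q 1) = ∑ p, x p * c p q := by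
  rw [mixedCost]
  refine Finset.sum_congr rfl fun p _ => ?_
  rw [Finset.sum_eq_single q (fun b _ hb => by simp [Pi.single_eq_of_ne hb]) (by simp)]
  simp

theorem globalCost_single [DecidableEq A₁] [DecidableEq A₂] (f : V → A₁ → A₂ → ℝ) (p : A₁)
    (q : A₂) : globalCost f (Pi.single p 1) (Pi.single q 1) =
      (1 / (Fintype.card V : ℝ)) * ∑ i, f i p q := by
  rw [globalCost_eq_mixedCost, mixedCost_single_left,
    Finset.sum_eq_single q (fun b _ hb => by simp [Pi.single_eq_of_ne hb]) (by simp)]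
  simp

/-- If the equilibrium set has a relative interior point, the global cost is constant on mixed
profiles. -/
theorem globalCost_eq_of_isInteriorPoint {f : V → A₁ → A₂ → ℝ} {x : (A₁ → ℝ) × (A₂ → ℝ)}
    (hx : IsInteriorPoint (nashSet f) x) {y₁ : A₁ → ℝ} {y₂ : A₂ → ℝ} (hy₁ : y₁ ∈ stdSimplex ℝ A₁)
    (hy₂ : y₂ ∈ stdSimplex ℝ A₂) : globalCost f y₁ y₂ = globalCost f x.1 x.2 := by
  obtain ⟨x₁, x₂⟩ := x
  obtain ⟨⟨hx₁, hx₂, hmin, hmax⟩, ε, hε, hball⟩ := hx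
  have hcont : Tendsto (fun s : ℝ => ((1 - s) • x₁ + s • y₁, (1 - s) • x₂ + s • y₂)) (𝓝 0)
      (𝓝 (x₁, x₂)) := by
    have : Continuous fun s : ℝ => ((1 - s) • x₁ + s • y₁, (1 - s) • x₂ + s • y₂) := by fun_prop
    simpa using this.tendsto 0
  have hev : ∀ᶠ s in 𝓝[>] (0 : ℝ), (((1 - s) • x₁ + s • y₁, (1 - s) • x₂ + s • y₂) :
      (A₁ → ℝ) × (A₂ → ℝ)) ∈ Metric.ball (x₁, x₂) ε ∧ s ∈ Set.Ioo (0 : ℝ) 1 :=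
    ((hcont.eventually (Metric.ball_mem_nhds _ hε)).filter_mono nhdsWithin_le_nhds).and
      (Ioo_mem_nhdsGT one_pos)
  obtain ⟨s, hs, hs0, hs1⟩ := hev.exists
  have hz₁ : (1 - s) • x₁ + s • y₁ ∈ stdSimplex ℝ A₁ :=
    convex_stdSimplex ℝ A₁ hx₁ hy₁ (by linarith) hs0.le (by ring)
  have hz₂ : (1 - s) • x₂ + s • y₂ ∈ stdSimplex ℝ A₂ :=
    convex_stdSimplex ℝ A₂ hx₂ hy₂ (by linarith) hs0.le (by ring)
  have hL₁ := fun w => mixedCost_combo_left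
    (fun p q => (1 / (Fintype.card V : ℝ)) * ∑ i, f i p q) s x₁ y₁ w
  have hL₂ := fun w => mixedCost_combo_right
    (fun p q => (1 / (Fintype.card V : ℝ)) * ∑ i, f i p q) s w x₂ y₂
  simp only [← globalCost_eq_mixedCost] at hL₁ hL₂
  set z₁ := (1 - s) • x₁ + s • y₁
  set z₂ := (1 - s) • x₂ + s • y₂
  rw [Metric.mem_ball, Prod.dist_eq, max_lt_iff] at hs
  -- The product metric is the maximum of the two distances, so the strategies can be varied
  -- independently near `(x₁, x₂)`.
  have hN : ∀ w₁ ∈ stdSimplex ℝ A₁, ∀ w₂ ∈ stdSimplex ℝ A₂, dist w₁ x₁ < ε → dist w₂ x₂ < ε →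
      (w₁, w₂) ∈ nashSet f := fun w₁ h₁ w₂ h₂ d₁ d₂ =>
    hball ⟨by rw [Metric.mem_ball, Prod.dist_eq]; exact max_lt d₁ d₂, h₁, h₂⟩
  have hzx := hN z₁ hz₁ x₂ hx₂ hs.1 (by simpa)
  have hxz := hN x₁ hx₁ z₂ hz₂ (by simpa) hs.2
  have hzz := hN z₁ hz₁ z₂ hz₂ hs.1 hs.2
  -- Two minimizers against the same opponent, or two maximizers, have equal value; `e3` squeezes
  -- `(z₁, z₂)` between the two resulting equalities.
  have e1 : globalCost f z₁ x₂ = globalCost f x₁ x₂ :=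
    le_antisymm (hzx.2.2.1 hx₁) (hmin hz₁)
  have e2 : globalCost f x₁ z₂ = globalCost f x₁ x₂ :=
    le_antisymm (hmax hz₂) (hxz.2.2.2 hx₂)
  have e3 : globalCost f z₁ z₂ = globalCost f x₁ x₂ :=
    le_antisymm ((hzz.2.2.1 hx₁).trans e2.le) (e1.ge.trans (hzz.2.2.2 hx₂))
  -- As `s ≠ 0`, affinity in each variable extrapolates the value from the nearby `z₁`, `z₂` to
  -- `y₁`, `y₂`.
  have e4 : globalCost f y₁ z₂ = globalCost f x₁ x₂ := by
    rw [hL₁, e2] at e3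
    exact mul_left_cancel₀ hs0.ne' (by linarith)
  have e5 : globalCost f y₁ x₂ = globalCost f x₁ x₂ := by
    rw [hL₁] at e1
    exact mul_left_cancel₀ hs0.ne' (by linarith)
  rw [hL₂, e5] at e4
  exact mul_left_cancel₀ hs0.ne' (by linarith)

theorem mem_nashSet_of_globalCost_const {f : V → A₁ → A₂ → ℝ} {c : ℝ}
    (hc : ∀ y₁ ∈ stdSimplex ℝ A₁, ∀ y₂ ∈ stdSimplex ℝ A₂, globalCost f y₁ y₂ = c)
    {y₁ : A₁ → ℝ} {y₂ : A₂ → ℝ} (h₁ : y₁ ∈ stdSimplex ℝ A₁) (h₂ : y₂ ∈ stdSimplex ℝ A₂) :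
    (y₁, y₂) ∈ nashSet f :=
  ⟨h₁, h₂, fun z hz => by simp only [Set.mem_ofPred_eq, hc _ h₁ _ h₂, hc z hz _ h₂, le_refl],
    fun z hz => by simp only [Set.mem_ofPred_eq, hc _ h₁ _ h₂, hc _ h₁ z hz, le_refl]⟩

/-- Evaluating at the vertices of the simplices turns constancy into the entrywise identity that
cancels the replicator terms. -/
theorem sum_eq_of_globalCost_const [Nonempty V] [DecidableEq A₁] [DecidableEq A₂]
    {f : V → A₁ → A₂ → ℝ} {c : ℝ}
    (hc : ∀ y₁ ∈ stdSimplex ℝ A₁, ∀ y₂ ∈ stdSimplex ℝ A₂, globalCost f y₁ y₂ = c) (p : A₁)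
    (q : A₂) : ∑ i, f i p q = Fintype.card V * c := by
  have hn : (Fintype.card V : ℝ) ≠ 0 := Nat.cast_ne_zero.2 Fintype.card_ne_zero
  rw [← hc _ (single_mem_stdSimplex ℝ p) _ (single_mem_stdSimplex ℝ q), globalCost_single,
    ← mul_assoc, mul_one_div_cancel hn, one_mul]

end Game

/-! ### The algorithm as stochastic averaging, and its convergence -/

theorem weightedAverage_eq_sum {V A : Type*} [Fintype V] {S : Set V} {w : V → ℝ}
    (hw : ∀ j ∉ S, w j = 0) (x : V → A → ℝ) :
    weightedAverage S w x = fun p => ∑ j, w j * x j p := by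
  classical
  ext p
  simp only [weightedAverage, Finset.sum_apply, Pi.smul_apply, smul_eq_mul]
  refine Finset.sum_subset (Finset.filter_subset _ _) fun j _ hj => ?_
  rw [hw j (by simpa using hj), zero_mul]

theorem uniform_mem_stdSimplex (A : Type*) [Fintype A] [Nonempty A] :
    (fun _ => 1 / (Fintype.card A : ℝ)) ∈ stdSimplex ℝ A := by
  refine ⟨fun _ => by positivity, ?_⟩
  rw [Finset.sum_const, Finset.card_univ, nsmul_eq_mul, mul_one_div_cancel]
  exact Nat.cast_ne_zero.2 Fintype.card_ne_zero

theorem nonneg_of_lower_of_zero {V V' : Type*} {w : V → V' → ℝ} {S : V → Set V'} {η : ℝ}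
    (hη : 0 ≤ η) (hlow : ∀ i, ∀ j ∈ S i, η ≤ w i j) (hzero : ∀ i j, j ∉ S i → w i j = 0)
    (i : V) (j : V') : 0 ≤ w i j := by
  by_cases hj : j ∈ S i
  · exact hη.trans (hlow i j hj)
  · exact (hzero i j hj).ge

end SubnetworkGame

theorem theorem4
    {V₁ V₂ A₁ A₂ : Type*}
    [Fintype V₁] [Nonempty V₁] [Fintype V₂] [Nonempty V₂]
    [Fintype A₁] [Nonempty A₁] [DecidableEq A₁] [Fintype A₂] [Nonempty A₂] [DecidableEq A₂]
    (f₁ : V₁ → A₁ → A₂ → ℝ) (f₂ : V₂ → A₁ → A₂ → ℝ)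
    (hzero : SubnetworkGame.IsZeroSum f₁ f₂)
    (N : SubnetworkGame.Network V₁ V₂) (hN : N.Admissible)
    (α : ℕ → ℝ) (hα_pos : ∀ t, 0 < α t) (hα_anti : Antitone α)
    (hα_sum : Tendsto (fun T => ∑ t ∈ Finset.range T, α t) atTop atTop)
    (hα_sq : Summable (fun t => α t ^ 2))
    (hint : ∃ x, SubnetworkGame.IsInteriorPoint (SubnetworkGame.nashSet f₁) x) :
    ∃ x ∈ SubnetworkGame.nashSet f₁,
      (∀ i : V₁, Tendsto (fun t => (SubnetworkGame.mwIterates f₁ f₂ N α t).1 i) atTop (𝓝 x.1)) ∧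
      (∀ j : V₂, Tendsto (fun t => (SubnetworkGame.mwIterates f₁ f₂ N α t).2 j) atTop (𝓝 x.2)) := by
  open SubnetworkGame in
  obtain ⟨xs, hxs⟩ := hint
  have hconst₁ : ∀ y₁ ∈ stdSimplex ℝ A₁, ∀ y₂ ∈ stdSimplex ℝ A₂,
      globalCost f₁ y₁ y₂ = globalCost f₁ xs.1 xs.2 :=
    fun y₁ h₁ y₂ h₂ => globalCost_eq_of_isInteriorPoint hxs h₁ h₂
  have hconst₂ : ∀ y₁ ∈ stdSimplex ℝ A₁, ∀ y₂ ∈ stdSimplex ℝ A₂,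
      globalCost f₂ y₁ y₂ = -globalCost f₁ xs.1 xs.2 := fun y₁ h₁ y₂ h₂ => by
    linarith [hzero y₁ h₁ y₂ h₂, hconst₁ y₁ h₁ y₂ h₂]
  obtain ⟨η, hη0, hη1, hlow⟩ := hN.weights_lower
  have hmix₁ : IsMixing N.G₁ N.W₁ η :=
    ⟨hN.connected₁, hη0, hη1, hN.self₁, fun k => (hlow k).1,
      fun k => nonneg_of_lower_of_zero hη0.le (hlow k).1 (hN.zero₁ k), hN.row_sum₁⟩
  have hmix₂ : IsMixing N.G₂ N.W₂ η :=
    ⟨hN.connected₂, hη0, hη1, hN.self₂, fun k => (hlow k).2.1,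
      fun k => nonneg_of_lower_of_zero hη0.le (hlow k).2.1 (hN.zero₂ k), hN.row_sum₂⟩
  have hW₁₂ : ∀ k i, N.W₁₂ k i ∈ stdSimplex ℝ V₂ := fun k i =>
    ⟨nonneg_of_lower_of_zero hη0.le (hlow k).2.2.1 (hN.zero₁₂ k) i, hN.row_sum₁₂ k i⟩
  have hW₂₁ : ∀ k i, N.W₂₁ k i ∈ stdSimplex ℝ V₁ := fun k i =>
    ⟨nonneg_of_lower_of_zero hη0.le (hlow k).2.2.2 (hN.zero₂₁ k) i, hN.row_sum₂₁ k i⟩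
  set x₁ : ℕ → V₁ → A₁ → ℝ := fun t => (mwIterates f₁ f₂ N α t).1 with hx₁
  set x₂ : ℕ → V₂ → A₂ → ℝ := fun t => (mwIterates f₁ f₂ N α t).2 with hx₂
  have hstep₁ : ∀ t i, x₁ (t + 1) i = mwStep (α t)
      (fun p => ∑ q, (∑ j, N.W₁₂ t i j * x₂ t j q) * f₁ i p q)
      (fun p => ∑ j, N.W₁ t i j * x₁ t j p) := fun t i => by
    simp only [hx₁, hx₂, mwIterates, weightedAverage_eq_sum (hN.zero₁ t i),
      weightedAverage_eq_sum (hN.zero₁₂ t i), mixedCost_single_left]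
  have hstep₂ : ∀ t i, x₂ (t + 1) i = mwStep (α t)
      (fun q => ∑ p, (∑ j, N.W₂₁ t i j * x₁ t j p) * f₂ i p q)
      (fun q => ∑ j, N.W₂ t i j * x₂ t j q) := fun t i => by
    simp only [hx₁, hx₂, mwIterates, weightedAverage_eq_sum (hN.zero₂ t i),
      weightedAverage_eq_sum (hN.zero₂₁ t i), mixedCost_single_right]
  have hmem₁ : ∀ t i, x₁ t i ∈ stdSimplex ℝ A₁ := fun t => by
    induction t with
    | zero => exact fun _ => uniform_mem_stdSimplex A₁
    | succ t ih =>
      intro i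
      rw [hstep₁]
      exact mwStep_mem_stdSimplex
        (average_mem_stdSimplex ⟨hmix₁.nonneg t i, hmix₁.row_sum t i⟩ ih)
  have hmem₂ : ∀ t i, x₂ t i ∈ stdSimplex ℝ A₂ := fun t => by
    induction t with
    | zero => exact fun _ => uniform_mem_stdSimplex A₂
    | succ t ih =>
      intro i
      rw [hstep₂]
      exact mwStep_mem_stdSimplex
        (average_mem_stdSimplex ⟨hmix₂.nonneg t i, hmix₂.row_sum t i⟩ ih)
  have htraj₁ : IsMWTrajectory f₁ N.W₁ α (fun t i q => ∑ j, N.W₁₂ t i j * x₂ t j q) x₁ :=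
    ⟨hmem₁, fun t i => average_mem_stdSimplex (hW₁₂ t i) (hmem₂ t), hstep₁⟩
  -- Swapping the action arguments lets the second subnetwork, which descends its own cost `f₂`, be
  -- treated like the first.
  have htraj₂ : IsMWTrajectory (fun i q p => f₂ i p q) N.W₂ α
      (fun t i p => ∑ j, N.W₂₁ t i j * x₁ t j p) x₂ :=
    ⟨hmem₂, fun t i => average_mem_stdSimplex (hW₂₁ t i) (hmem₁ t), hstep₂⟩
  obtain ⟨E₁, hE₁0, hE₁s, hE₁⟩ := htraj₁.exists_spread_bound hmix₁ hα_pos hα_anti hα_sq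
  obtain ⟨E₂, hE₂0, hE₂s, hE₂⟩ := htraj₂.exists_spread_bound hmix₂ hα_pos hα_anti hα_sq
  have hEs : Summable fun t => (E₁ t + E₂ t) ^ 2 :=
    Summable.of_nonneg_of_le (fun t => sq_nonneg _) (fun t => add_sq_le)
      ((hE₁s.add hE₂s).mul_left 2)
  have hE₁' : ∀ t i j p, |x₁ t i p - x₁ t j p| ≤ E₁ t + E₂ t := fun t i j p =>
    (hE₁ t i j p).trans (le_add_of_nonneg_right (hE₂0 t))
  have hE₂' : ∀ t i j q, |x₂ t i q - x₂ t j q| ≤ E₁ t + E₂ t := fun t i j q =>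
    (hE₂ t i j q).trans (le_add_of_nonneg_left (hE₁0 t))
  obtain ⟨i₀⟩ := ‹Nonempty V₁›
  obtain ⟨j₀⟩ := ‹Nonempty V₂›
  have : Nonempty V₁ := ⟨i₀⟩
  have : Nonempty V₂ := ⟨j₀⟩
  -- The received average is a convex combination of the opponents' estimates, so it is within their
  -- spread of the reference agent `j₀`.
  obtain ⟨l₁, hl₁, hlim₁⟩ := htraj₁.exists_tendsto hmix₁ hN.col_sum₁ hα_pos hα_anti hα_sq
    (sum_eq_of_globalCost_const hconst₁) hEs hE₁' (fun t => hmem₂ t j₀) fun t i q =>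
      abs_sum_sub_le_of_stochastic (hW₁₂ t i).1 (hW₁₂ t i).2 fun j => hE₂' t j j₀ q
  obtain ⟨l₂, hl₂, hlim₂⟩ := htraj₂.exists_tendsto hmix₂ hN.col_sum₂ hα_pos hα_anti hα_sq
    (fun q p => sum_eq_of_globalCost_const hconst₂ p q) hEs hE₂' (fun t => hmem₁ t i₀)
      fun t i p => abs_sum_sub_le_of_stochastic (hW₂₁ t i).1 (hW₂₁ t i).2 fun j => hE₁' t j i₀ p
  exact ⟨(l₁, l₂), mem_nashSet_of_globalCost_const hconst₁ hl₁ hl₂, hlim₁, hlim₂⟩
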